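/- \textbf{Definitions.} Let $\Gamma$ be a (Borel) probability distribution on $[0,1]\times\{0,1\}$. For $w>0$, $r\in\mathbb{R}$ and $j\in\mathbb{Z}$ let $I^{w}_{r,j}=[r+jw,\,r+(j+1)w)$, and define \[ \mathsf{RintCE}(\Gamma,w)=\mathbb{E}_{r}\Big[\sum_{j\in\mathbb{Z}}\Big|\mathbb{E}_{(v,y)\sim\Gamma}\big[(y-v)\mathbf{1}(v\in I^{w}_{r,j})\big]\Big|\Big],\qquad \mathsf{SintCE}(\Gamma)=\inf_{k\in\mathbb{Z}_{\ge 0}}\big(\mathsf{RintCE}(\Gamma,2^{-k})+2^{-k}\big), \] where $r$ is uniform on $[0,w)$. Given $\varepsilon\in(0,1/4)$, let $k^*\in\mathbb{Z}_{\ge 0}$ be the integer with $\varepsilon/4<2^{-k^*}\le\varepsilon/2$. Draw $(v_1,y_1),\dots,(v_n,y_n)$ i.i.d. from $\Gamma$ and, for each $k=0,\dots,k^*$, draw $r_{k,1},\dots,r_{k,m}$ uniformly from $[0,2^{-k})$, all draws being mutually independent. Put \[ \widehat{\mathsf{RintCE}}(\Gamma,2^{-k})=\frac1m\sum_{s=1}^m\sum_{j\in\mathbb{Z}}\Big|\frac1n\sum_{\ell=1}^n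 (y_\ell-v_\ell)\mathbf{1}\big(v_\ell\in I^{2^{-k}}_{r_{k,s},j}\big)\Big|,\qquad \widehat{\mathsf{SintCE}}(\Gamma)=\min_{k=0,\dots,k^*}\big(\widehat{\mathsf{RintCE}}(\Gamma,2^{-k})+2^{-k}\big). \] \textbf{Theorem.} There exists an absolute constant $C>0$ such that the following holds. Let $\varepsilon,\delta\in(0,1/4)$, let $k^*$ be as above, and let $n,m$ be integers with \[ n\ge C\varepsilon^{-3}+C\varepsilon^{-2}\log(1/\delta),\qquad m\ge C\varepsilon^{-2}\log(k^*/\delta). \] Then for every probability distribution $\Gamma$ on $[0,1]\times\{0,1\}$, with probability at least $1-\delta$ over the draws, \[ \big|\widehat{\mathsf{SintCE}}(\Gamma)-\mathsf{SintCE}(\Gamma)\big|\le\varepsilon . \] -/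

import Mathlib

open MeasureTheory ProbabilityTheory

namespace IntervalCalibration

/-- A prediction-label pair `(v, y)` with `v ∈ [0,1]` and `y ∈ {0,1}` (`false` is `0`, `true` is `1`),
with the product of the Borel and the discrete σ-algebras. -/
abbrev PredLabel : Type := ↥(Set.Icc (0 : ℝ) 1) × Bool

/-- The residual `y - v` of a prediction-label pair, as a real number. -/
noncomputable def residual (z : PredLabel) : ℝ := (if z.2 then 1 else 0) - (z.1 : ℝ)

/-- The shifted interval `I_{r,j}^w = [r + j w, r + (j + 1) w)` of width `w`. -/
def shiftedInterval (w r : ℝ) (j : ℤ) : Set ℝ := Set.Ico (r + j * w) (r + (j + 1) * w)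

/-- `(y - v) 𝟏(v ∈ I_{r,j}^w)`. -/
noncomputable def binnedResidual (w r : ℝ) (j : ℤ) (z : PredLabel) : ℝ :=
  residual z * (shiftedInterval w r j).indicator 1 (z.1 : ℝ)

/-- The uniform distribution on `[0, w)`. -/
noncomputable def uniformShift (w : ℝ) : Measure ℝ := volume[|Set.Ico 0 w]

/-- Random interval calibration error
`RintCE(Γ, w) = E_r ∑_j |E_{(v,y) ∼ Γ} [(y - v) 𝟏(v ∈ I_{r,j}^w)]|`, with `r` uniform on `[0, w)`.
For `w > 0` only finitely many `j : ℤ` contribute to the sum. -/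
noncomputable def RintCE (Γ : Measure PredLabel) (w : ℝ) : ℝ :=
  ∫ r, ∑' j : ℤ, |∫ z, binnedResidual w r j z ∂Γ| ∂(uniformShift w)

/-- The dyadic width `2^{-k}`. -/
noncomputable def width (k : ℕ) : ℝ := (1 / 2) ^ k

/-- Surrogate interval calibration error `SintCE(Γ) = inf_k (RintCE(Γ, 2^{-k}) + 2^{-k})`. -/
noncomputable def SintCE (Γ : Measure PredLabel) : ℝ :=
  ⨅ k : ℕ, (RintCE Γ (width k) + width k)

/-- The empirical version of `RintCE(Γ, w)` computed from the examples `z` and the shifts `r`. -/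
noncomputable def empRintCE {n m : ℕ} (z : Fin n → PredLabel) (r : Fin m → ℝ) (w : ℝ) : ℝ :=
  (1 / (m : ℝ)) * ∑ s : Fin m, ∑' j : ℤ,
    |(1 / (n : ℝ)) * ∑ l : Fin n, binnedResidual w (r s) j (z l)|

/-- The estimator of `SintCE(Γ)`: the minimum over `k = 0, …, K` of the empirical `RintCE` at width
`2^{-k}`, computed with the shifts `r k 0, …, r k (m - 1)`, plus `2^{-k}`. -/
noncomputable def empSintCE {n m K : ℕ} (z : Fin n → PredLabel) (r : Fin (K + 1) → Fin m → ℝ) : ℝ :=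
  Finset.univ.inf' Finset.univ_nonempty
    (fun k : Fin (K + 1) => empRintCE z (r k) (width k) + width k)

/-- The joint law of all the draws: `n` examples from `Γ` and, for each `k = 0, …, K`, `m` shifts from
the uniform distribution on `[0, 2^{-k})`, all of them mutually independent. -/
noncomputable def drawLaw (Γ : Measure PredLabel) (n m K : ℕ) :
    Measure ((Fin n → PredLabel) × (Fin (K + 1) → Fin m → ℝ)) :=
  (Measure.pi fun _ : Fin n => Γ).prod
    (Measure.pi fun k : Fin (K + 1) => Measure.pi fun _ : Fin m => uniformShift (width k))

end IntervalCalibration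

/-!
Two facts reduce the theorem to a simultaneous estimate of `RintCE Γ 2^{-k}` for `k = 0, …, K`,
where `K = k*`.

*Truncation.* Halving the width splits every interval in two, so by the triangle inequality
`RintCE Γ (2 w) ≤ RintCE Γ w` (`RintCE_two_mul_le`; the error at a fixed shift is `w`-periodic, so
averaging over `[0, 2w)` or over `[0, w)` is the same). Hence the widths below `2^{-K}` lower the
infimum in `SintCE Γ` by at most `2^{-K} ≤ ε / 2` (`abs_inf'_sub_SintCE_le`), and it suffices that
every `RintCE Γ 2^{-k}` with `k ≤ K` is estimated up to `ε / 2`.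

*Splitting the error.* At a fixed width the error is at most the average over the drawn shifts of
the `ℓ¹` distance `binDeviation` between empirical and true bin means, plus the deviation of the
average of `shiftCE Γ` over the drawn shifts from its mean `RintCE Γ`
(`abs_empRintCE_sub_RintCE_le`). Each part should be at most `ε / 4`.

The second part is an average of independent `[0,1]`-valued variables, and Hoeffding's inequality
applies. For the first part, fix the shifts. At most `2^k + 2` intervals matter, so the `ℓ¹` distance
is a maximum over `2^(2^k + 2)` sign patterns, each giving an average of `n` independent variables
with values in `[-1, 1]`. Bounding the exponential of the maximum by the sum of the exponentials
gives `E exp (t n binDeviation) ≤ 2^(2^k + 2) exp (n t² / 2)` (`lintegral_exp_binDeviation_le`).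
By convexity of `exp` the same bound holds for the average over the shifts, whatever their number,
and Markov's inequality gives the tail bound (`measure_average_binDeviation_ge_le`). As
`2^K < 4 / ε`, the number of sign patterns is `exp (O(1 / ε))`, which is absorbed by the term
`C / ε³` in the number of examples (`examples_failure_le`); the same term pays for the union bound
over the `K + 1` widths.
-/

namespace IntervalCalibration

/-! ### Binned residuals -/

/-- The contribution `E_{(v,y) ∼ Γ} [(y - v) 𝟏(v ∈ I_{r,j}^w)]` of one interval. -/
noncomputable def binMean (Γ : Measure PredLabel) (w r : ℝ) (j : ℤ) : ℝ :=
  ∫ z, binnedResidual w r j z ∂Γ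

/-- The interval calibration error of `Γ` at width `w` for one fixed shift `r`;
`RintCE Γ w` is its average over `r`. -/
noncomputable def shiftCE (Γ : Measure PredLabel) (w r : ℝ) : ℝ :=
  ∑' j : ℤ, |binMean Γ w r j|

lemma abs_residual_le_one (z : PredLabel) : |residual z| ≤ 1 := by
  obtain ⟨⟨v, h0, h1⟩, y⟩ := z
  rw [abs_le]
  cases y <;> simp [residual] <;> constructor <;> linarith

lemma binnedResidual_eq_ite (w r : ℝ) (j : ℤ) (z : PredLabel) :
    binnedResidual w r j z =
      if r + j * w ≤ (z.1 : ℝ) ∧ (z.1 : ℝ) < r + (j + 1) * w then residual z else 0 := by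
  unfold binnedResidual shiftedInterval
  by_cases h : (z.1 : ℝ) ∈ Set.Ico (r + j * w) (r + (j + 1) * w)
  · rw [Set.indicator_of_mem h, if_pos (Set.mem_Ico.1 h)]; simp
  · rw [Set.indicator_of_notMem h, if_neg fun hh => h (Set.mem_Ico.2 hh)]; simp

lemma mem_shiftedInterval_iff {w : ℝ} (hw : 0 < w) (r : ℝ) (j : ℤ) (v : ℝ) :
    (r + j * w ≤ v ∧ v < r + (j + 1) * w) ↔ ⌊(v - r) / w⌋ = j := by
  rw [Int.floor_eq_iff, le_div_iff₀ hw, div_lt_iff₀ hw]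
  constructor <;> rintro ⟨h1, h2⟩ <;> constructor <;> linarith

lemma binnedResidual_eq_ite_floor {w : ℝ} (hw : 0 < w) (r : ℝ) (j : ℤ) (z : PredLabel) :
    binnedResidual w r j z = if ⌊((z.1 : ℝ) - r) / w⌋ = j then residual z else 0 := by
  rw [binnedResidual_eq_ite]
  simp only [mem_shiftedInterval_iff hw]

lemma measurable_residual : Measurable residual := by
  unfold residual
  have h : MeasurableSet {z : PredLabel | z.2 = true} :=
    measurable_snd (measurableSet_singleton true)
  exact (Measurable.ite h measurable_const measurable_const).sub
    (measurable_subtype_coe.comp measurable_fst)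

lemma measurable_binnedResidual_uncurry (w : ℝ) (j : ℤ) :
    Measurable fun p : ℝ × PredLabel => binnedResidual w p.1 j p.2 := by
  simp only [binnedResidual_eq_ite]
  have hv : Measurable fun p : ℝ × PredLabel => (p.2.1 : ℝ) :=
    measurable_subtype_coe.comp (measurable_fst.comp measurable_snd)
  refine Measurable.ite ?_ (measurable_residual.comp measurable_snd) measurable_const
  exact (measurableSet_le (measurable_fst.add_const _) hv).inter
    (measurableSet_lt hv (measurable_fst.add_const _))

lemma measurable_binnedResidual (w r : ℝ) (j : ℤ) : Measurable (binnedResidual w r j) :=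
  (measurable_binnedResidual_uncurry w j).comp (measurable_const.prodMk measurable_id)

/-- The intervals of one shift are disjoint, so a prediction lies in at most one of them. -/
lemma sum_abs_binnedResidual_le_one {w : ℝ} (hw : 0 < w) (r : ℝ) (s : Finset ℤ) (z : PredLabel) :
    ∑ j ∈ s, |binnedResidual w r j z| ≤ 1 := by
  simp only [binnedResidual_eq_ite_floor hw, apply_ite abs, abs_zero]
  rw [Finset.sum_ite_eq]
  split_ifs
  · exact abs_residual_le_one z
  · exact zero_le_one

lemma abs_binnedResidual_le_one {w : ℝ} (hw : 0 < w) (r : ℝ) (j : ℤ) (z : PredLabel) :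
    |binnedResidual w r j z| ≤ 1 := by
  simpa using sum_abs_binnedResidual_le_one hw r {j} z

lemma integrable_of_measurable_of_abs_le_one {α : Type*} [MeasurableSpace α] {μ : Measure α}
    [IsFiniteMeasure μ] {f : α → ℝ} (hf : Measurable f) (hb : ∀ x, |f x| ≤ 1) :
    Integrable f μ :=
  Integrable.of_bound hf.aestronglyMeasurable 1 (Filter.Eventually.of_forall hb)

lemma integrable_binnedResidual (Γ : Measure PredLabel) [IsProbabilityMeasure Γ] {w : ℝ}
    (hw : 0 < w) (r : ℝ) (j : ℤ) : Integrable (binnedResidual w r j) Γ :=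
  integrable_of_measurable_of_abs_le_one (measurable_binnedResidual w r j)
    (abs_binnedResidual_le_one hw r j)

lemma measurable_binMean (Γ : Measure PredLabel) [IsProbabilityMeasure Γ] (w : ℝ) (j : ℤ) :
    Measurable fun r => binMean Γ w r j :=
  (StronglyMeasurable.integral_prod_right (ν := Γ)
    (measurable_binnedResidual_uncurry w j).stronglyMeasurable).measurable

/-! ### The calibration error at a fixed shift -/

lemma sum_abs_binMean_le_one (Γ : Measure PredLabel) [IsProbabilityMeasure Γ] {w : ℝ}
    (hw : 0 < w) (r : ℝ) (s : Finset ℤ) : ∑ j ∈ s, |binMean Γ w r j| ≤ 1 := by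
  have hint : ∀ j ∈ s, Integrable (fun z => |binnedResidual w r j z|) Γ :=
    fun j _ => (integrable_binnedResidual Γ hw r j).abs
  calc ∑ j ∈ s, |binMean Γ w r j| ≤ ∑ j ∈ s, ∫ z, |binnedResidual w r j z| ∂Γ :=
        Finset.sum_le_sum fun j _ => abs_integral_le_integral_abs
    _ = ∫ z, ∑ j ∈ s, |binnedResidual w r j z| ∂Γ := (integral_finsetSum s hint).symm
    _ ≤ ∫ _, (1 : ℝ) ∂Γ := integral_mono (integrable_finsetSum s hint) (integrable_const 1)
        fun z => sum_abs_binnedResidual_le_one hw r s z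
    _ = 1 := by simp

lemma summable_abs_binMean (Γ : Measure PredLabel) [IsProbabilityMeasure Γ] {w : ℝ}
    (hw : 0 < w) (r : ℝ) : Summable fun j => |binMean Γ w r j| :=
  summable_of_sum_le (fun _ => abs_nonneg _) (sum_abs_binMean_le_one Γ hw r)

lemma shiftCE_nonneg (Γ : Measure PredLabel) (w r : ℝ) : 0 ≤ shiftCE Γ w r :=
  tsum_nonneg fun _ => abs_nonneg _

lemma abs_shiftCE_le_one (Γ : Measure PredLabel) [IsProbabilityMeasure Γ] {w : ℝ}
    (hw : 0 < w) (r : ℝ) : |shiftCE Γ w r| ≤ 1 := by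
  rw [abs_of_nonneg (shiftCE_nonneg Γ w r)]
  exact Real.tsum_le_of_sum_le (fun _ => abs_nonneg _) (sum_abs_binMean_le_one Γ hw r)

lemma measurable_shiftCE (Γ : Measure PredLabel) [IsProbabilityMeasure Γ] (w : ℝ) :
    Measurable (shiftCE Γ w) :=
  Measurable.tsum fun j => (measurable_binMean Γ w j).abs

/-! ### Monotonicity in the width -/

lemma injective_two_mul_int : Function.Injective fun j : ℤ => 2 * j := by
  intro a b (h : 2 * a = 2 * b)
  omega

lemma injective_two_mul_add_one_int : Function.Injective fun j : ℤ => 2 * j + 1 := by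
  intro a b (h : 2 * a + 1 = 2 * b + 1)
  omega

lemma tsum_int_even_add_odd {f : ℤ → ℝ} (he : Summable fun j => f (2 * j))
    (ho : Summable fun j => f (2 * j + 1)) :
    ∑' j, f (2 * j) + ∑' j, f (2 * j + 1) = ∑' j, f j := by
  have h1 := (injective_two_mul_int.hasSum_range_iff (f := f)).2 he.hasSum
  have h2 := (injective_two_mul_add_one_int.hasSum_range_iff (f := f)).2 ho.hasSum
  refine (HasSum.add_isCompl ?_ h1 h2).tsum_eq.symm
  have hE : Set.range (fun j : ℤ => 2 * j) = {n | Even n} := by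
    ext n
    simp [even_iff_exists_two_mul]
  have hO : Set.range (fun j : ℤ => 2 * j + 1) = {n | Odd n} := by
    ext n
    simp [Odd]
  rw [hE, hO]
  exact Int.isCompl_even_odd

/-- An interval of width `2w` is the disjoint union of two intervals of width `w`. -/
lemma binnedResidual_two_mul {w : ℝ} (hw : 0 < w) (r : ℝ) (j : ℤ) (z : PredLabel) :
    binnedResidual (2 * w) r j z =
      binnedResidual w r (2 * j) z + binnedResidual w r (2 * j + 1) z := by
  simp only [binnedResidual_eq_ite]
  push_cast
  have h : ∀ v : ℝ, v < r + (2 * (j : ℝ) + 1) * w ∨ r + (2 * (j : ℝ) + 1) * w ≤ v :=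
    fun v => lt_or_ge _ _
  rcases h z.1 with h | h
  · have h2 : (z.1 : ℝ) < r + (j + 1) * (2 * w) := by nlinarith
    rw [if_neg (c := r + (2 * (j : ℝ) + 1) * w ≤ (z.1 : ℝ) ∧ _) (fun hh => absurd hh.1 (not_le.2 h)),
      add_zero]
    simp only [h, h2, and_true]
    congr 2
    ring
  · have h2 : r + j * (2 * w) ≤ (z.1 : ℝ) := by nlinarith
    rw [if_neg (c := r + 2 * (j : ℝ) * w ≤ (z.1 : ℝ) ∧ _) (fun hh => absurd hh.2 (not_lt.2 h)),
      zero_add]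
    simp only [h, h2, true_and]
    congr 2
    ring

lemma shiftCE_two_mul_le (Γ : Measure PredLabel) [IsProbabilityMeasure Γ] {w : ℝ}
    (hw : 0 < w) (r : ℝ) : shiftCE Γ (2 * w) r ≤ shiftCE Γ w r := by
  have hs := summable_abs_binMean Γ hw r
  have hse : Summable fun j : ℤ => |binMean Γ w r (2 * j)| := hs.comp_injective injective_two_mul_int
  have hso : Summable fun j : ℤ => |binMean Γ w r (2 * j + 1)| :=
    hs.comp_injective injective_two_mul_add_one_int
  have hsplit : ∀ j, binMean Γ (2 * w) r j = binMean Γ w r (2 * j) + binMean Γ w r (2 * j + 1) := by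
    intro j
    unfold binMean
    rw [← integral_add (integrable_binnedResidual Γ hw r _) (integrable_binnedResidual Γ hw r _)]
    simp only [binnedResidual_two_mul hw]
  calc shiftCE Γ (2 * w) r
      ≤ ∑' j : ℤ, (|binMean Γ w r (2 * j)| + |binMean Γ w r (2 * j + 1)|) := by
        refine (summable_abs_binMean Γ (by positivity) r).tsum_le_tsum (fun j => ?_) (hse.add hso)
        rw [hsplit]
        exact abs_add_le _ _
    _ = shiftCE Γ w r := by
        rw [hse.tsum_add hso]
        exact tsum_int_even_add_odd (f := fun j => |binMean Γ w r j|) hse hso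

lemma binMean_add_width (Γ : Measure PredLabel) (w r : ℝ) (j : ℤ) :
    binMean Γ w (r + w) j = binMean Γ w r (j + 1) := by
  unfold binMean
  congr 1
  funext z
  simp only [binnedResidual_eq_ite]
  push_cast
  congr 3 <;> ring

lemma periodic_shiftCE (Γ : Measure PredLabel) (w : ℝ) : Function.Periodic (shiftCE Γ w) w := by
  intro r
  simp only [shiftCE, binMean_add_width]
  exact (Equiv.addRight (1 : ℤ)).tsum_eq fun j => |binMean Γ w r j|

lemma uniformShift_integral {w : ℝ} (hw : 0 < w) (f : ℝ → ℝ) :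
    ∫ r, f r ∂(uniformShift w) = w⁻¹ * ∫ r in (0 : ℝ)..w, f r := by
  rw [uniformShift, ProbabilityTheory.cond, integral_smul_measure,
    intervalIntegral.integral_of_le hw.le, integral_Ico_eq_integral_Ioc]
  simp [hw.le]

lemma isProbabilityMeasure_uniformShift {w : ℝ} (hw : 0 < w) :
    IsProbabilityMeasure (uniformShift w) :=
  cond_isProbabilityMeasure_of_finite (by simp [hw]) (by simp)

lemma RintCE_eq_integral_shiftCE (Γ : Measure PredLabel) (w : ℝ) :
    RintCE Γ w = ∫ r, shiftCE Γ w r ∂(uniformShift w) := rfl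

/-- Halving the width can only increase the error: each bin splits in two, and a uniform shift
modulo `2w` is also uniform modulo `w`. -/
lemma RintCE_two_mul_le (Γ : Measure PredLabel) [IsProbabilityMeasure Γ] {w : ℝ} (hw : 0 < w) :
    RintCE Γ (2 * w) ≤ RintCE Γ w := by
  have hint : ∀ u : ℝ, 0 < u → ∀ a b : ℝ, IntervalIntegrable (shiftCE Γ u) volume a b := by
    intro u hu a b
    have : IsFiniteMeasure (volume.restrict (Set.uIoc a b)) :=
      ⟨by simp [Set.uIoc]⟩
    rw [intervalIntegrable_iff]
    exact integrable_of_measurable_of_abs_le_one (measurable_shiftCE Γ u)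
      (abs_shiftCE_le_one Γ hu)
  rw [RintCE_eq_integral_shiftCE, RintCE_eq_integral_shiftCE,
    uniformShift_integral (by positivity), uniformShift_integral hw]
  have h1 : ∫ r in (0 : ℝ)..(2 * w), shiftCE Γ w r = 2 * ∫ r in (0 : ℝ)..w, shiftCE Γ w r := by
    rw [← intervalIntegral.integral_add_adjacent_intervals (hint w hw 0 w) (hint w hw w (2 * w))]
    have := (periodic_shiftCE Γ w).intervalIntegral_add_eq w 0
    rw [zero_add, ← two_mul] at this
    rw [this, two_mul]
  have h2 : ∫ r in (0 : ℝ)..(2 * w), shiftCE Γ (2 * w) r ≤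
      ∫ r in (0 : ℝ)..(2 * w), shiftCE Γ w r :=
    intervalIntegral.integral_mono_on (by positivity) (hint _ (by positivity) _ _) (hint w hw _ _)
      fun r _ => shiftCE_two_mul_le Γ hw r
  calc (2 * w)⁻¹ * ∫ r in (0 : ℝ)..(2 * w), shiftCE Γ (2 * w) r
      ≤ (2 * w)⁻¹ * (2 * ∫ r in (0 : ℝ)..w, shiftCE Γ w r) := by
        rw [← h1]
        gcongr
    _ = w⁻¹ * ∫ r in (0 : ℝ)..w, shiftCE Γ w r := by field_simp

lemma width_pos (k : ℕ) : 0 < width k := by unfold width; positivity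

lemma two_mul_width_succ (k : ℕ) : 2 * width (k + 1) = width k := by
  unfold width; rw [pow_succ]; ring

lemma monotone_RintCE_width (Γ : Measure PredLabel) [IsProbabilityMeasure Γ] :
    Monotone fun k => RintCE Γ (width k) := by
  refine monotone_nat_of_le_succ fun k => ?_
  rw [← two_mul_width_succ]
  exact RintCE_two_mul_le Γ (width_pos _)

lemma RintCE_nonneg (Γ : Measure PredLabel) (w : ℝ) : 0 ≤ RintCE Γ w :=
  integral_nonneg fun r => shiftCE_nonneg Γ w r

/-- Widths below `2^{-K}` lower the infimum defining `SintCE` by at most `2^{-K}`; hence uniformly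
good estimates at the widths `2^{-k}`, `k ≤ K`, give a good estimate of `SintCE`. -/
lemma abs_inf'_sub_SintCE_le (Γ : Measure PredLabel) [IsProbabilityMeasure Γ] (K : ℕ) {t : ℝ}
    (f : Fin (K + 1) → ℝ) (hf : ∀ k : Fin (K + 1), |f k - RintCE Γ (width k)| ≤ t) :
    |Finset.univ.inf' Finset.univ_nonempty (fun k => f k + width k) - SintCE Γ| ≤ t + width K := by
  have hf' := fun k => abs_le.1 (hf k)
  have hbdd : BddBelow (Set.range fun k : ℕ => RintCE Γ (width k) + width k) :=
    ⟨0, by rintro _ ⟨k, rfl⟩; exact add_nonneg (RintCE_nonneg _ _) (width_pos k).le⟩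
  rw [abs_le]
  constructor
  · obtain ⟨k, -, hk⟩ := Finset.exists_mem_eq_inf' Finset.univ_nonempty
      (fun k : Fin (K + 1) => f k + width k)
    rw [hk]
    have := ciInf_le hbdd (k : ℕ)
    change SintCE Γ ≤ _ at this
    linarith [(hf' k).1, width_pos K]
  · have hle : ∀ k : ℕ, Finset.univ.inf' Finset.univ_nonempty (fun k => f k + width k) -
        (t + width K) ≤ RintCE Γ (width k) + width k := by
      intro k
      rcases le_total k K with h | h
      · have := Finset.inf'_le (fun k : Fin (K + 1) => f k + width k)
          (Finset.mem_univ (⟨k, Nat.lt_succ_of_le h⟩ : Fin (K + 1)))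
        have h2 := hf' ⟨k, Nat.lt_succ_of_le h⟩
        simp only at this h2
        linarith [h2.2, width_pos K]
      · have := Finset.inf'_le (fun k : Fin (K + 1) => f k + width k)
          (Finset.mem_univ (Fin.last K))
        have h2 := hf' (Fin.last K)
        simp only [Fin.val_last] at this h2
        have h3 := monotone_RintCE_width Γ h
        simp only at h3
        linarith [h2.2, width_pos k]
    have := le_ciInf hle
    change _ ≤ SintCE Γ at this
    linarith

/-! ### Hoeffding bounds for product measures -/

/-- Hoeffding's lemma for the centred sum of `n` independent copies of a `[-1,1]`-valued variable. -/
lemma hasSubgaussianMGF_sum_pi {α : Type*} [MeasurableSpace α] (μ : Measure α)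
    [IsProbabilityMeasure μ] (n : ℕ) {X : α → ℝ} (hX : Measurable X) (hb : ∀ᵐ x ∂μ, |X x| ≤ 1) :
    HasSubgaussianMGF (fun z : Fin n → α => ∑ l, (X (z l) - ∫ x, X x ∂μ)) n
      (Measure.pi fun _ => μ) := by
  have h1 : HasSubgaussianMGF (fun x => X x - ∫ x, X x ∂μ) 1 μ := by
    have := hasSubgaussianMGF_of_mem_Icc (a := -1) (b := 1) hX.aemeasurable
      (hb.mono fun x hx => abs_le.1 hx)
    convert this using 1
    have : ‖(1 : ℝ) - -1‖₊ = 2 := by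
      rw [← NNReal.coe_inj]; norm_num
    rw [this]
    norm_num
  have hind : iIndepFun (fun (l : Fin n) (z : Fin n → α) => X (z l) - ∫ x, X x ∂μ)
      (Measure.pi fun _ => μ) :=
    iIndepFun_pi (X := fun _ x => X x - ∫ x, X x ∂μ) fun _ => (hX.sub_const _).aemeasurable
  have hmp : ∀ l : Fin n, MeasurePreserving (Function.eval l) (Measure.pi fun _ : Fin n => μ) μ :=
    fun l => measurePreserving_eval (fun _ : Fin n => μ) l
  have := HasSubgaussianMGF.sum_of_iIndepFun hind (c := fun _ => 1) (s := Finset.univ)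
    fun l _ => HasSubgaussianMGF.of_map (X := fun x => X x - ∫ x, X x ∂μ)
      (hmp l).measurable.aemeasurable ((hmp l).map_eq.symm ▸ h1)
  simpa using this

/-- Two-sided Hoeffding inequality for the average of `m` independent copies. -/
lemma measureReal_abs_average_sub_ge_le {α : Type*} [MeasurableSpace α] (μ : Measure α)
    [IsProbabilityMeasure μ] {m : ℕ} (hm : 0 < m) {X : α → ℝ} (hX : Measurable X)
    (hb : ∀ᵐ x ∂μ, |X x| ≤ 1) {t : ℝ} (ht : 0 ≤ t) :
    (Measure.pi fun _ : Fin m => μ).real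
      {r | t ≤ |(1 / (m : ℝ)) * ∑ s, X (r s) - ∫ x, X x ∂μ|} ≤ 2 * Real.exp (-(m * t ^ 2 / 2)) := by
  have hm' : (0 : ℝ) < m := by exact_mod_cast hm
  have hS := hasSubgaussianMGF_sum_pi μ m hX hb
  have hexp : ∀ Y : (Fin m → α) → ℝ, HasSubgaussianMGF Y m (Measure.pi fun _ => μ) →
      (Measure.pi fun _ : Fin m => μ).real {r | m * t ≤ Y r} ≤ Real.exp (-(m * t ^ 2 / 2)) := by
    intro Y hY
    refine (hY.measure_ge_le (by positivity)).trans_eq ?_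
    congr 1
    simp only [NNReal.coe_natCast]
    field_simp
  calc _ ≤ (Measure.pi fun _ : Fin m => μ).real
        ({r | m * t ≤ ∑ s, (X (r s) - ∫ x, X x ∂μ)} ∪
          {r | m * t ≤ (-fun r : Fin m → α => ∑ s, (X (r s) - ∫ x, X x ∂μ)) r}) := by
        refine measureReal_mono fun r hr => ?_
        have heq : m * ((1 / (m : ℝ)) * ∑ s, X (r s) - ∫ x, X x ∂μ) =
            ∑ s, (X (r s) - ∫ x, X x ∂μ) := by
          simp only [Finset.sum_sub_distrib, Finset.sum_const, Finset.card_univ, Fintype.card_fin,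
            nsmul_eq_mul]
          field_simp
        simp only [Set.mem_union, Set.mem_ofPred_eq, Pi.neg_apply, ← heq] at hr ⊢
        rcases le_abs.1 hr with h | h
        · left; gcongr
        · right; rw [← mul_neg]; gcongr
    _ ≤ _ := measureReal_union_le _ _
    _ ≤ _ := by linarith [hexp _ hS, hexp _ hS.neg]

/-! ### Deviation of the empirical bin means -/

/-- The intervals that can contain a point of `[0,1]` when the width is `2^{-k}` and the shift lies
in `[0, 2^{-k})`. -/
noncomputable def binIndices (k : ℕ) : Finset ℤ := Finset.Icc (-1) (2 ^ k)

/-- The empirical counterpart of `binMean`. -/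
noncomputable def empBinMean {n : ℕ} (z : Fin n → PredLabel) (w r : ℝ) (j : ℤ) : ℝ :=
  (1 / (n : ℝ)) * ∑ l : Fin n, binnedResidual w r j (z l)

/-- The `ℓ¹` distance between the empirical and the true bin means at width `2^{-k}` and shift `r`,
over `binIndices k`; for `r ∈ [0, 2^{-k})` the means vanish at all other indices. -/
noncomputable def binDeviation (Γ : Measure PredLabel) {n : ℕ} (k : ℕ) (z : Fin n → PredLabel)
    (r : ℝ) : ℝ :=
  ∑ j ∈ binIndices k, |empBinMean z (width k) r j - binMean Γ (width k) r j|

lemma card_binIndices (k : ℕ) : (binIndices k).card = 2 ^ k + 2 := by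
  rw [binIndices, Int.card_Icc, show (2 ^ k + 1 - -1 : ℤ) = ((2 ^ k + 2 : ℕ) : ℤ) by push_cast; ring,
    Int.toNat_natCast]

lemma binnedResidual_eq_zero {k : ℕ} {r : ℝ} (hr : r ∈ Set.Ico 0 (width k)) {j : ℤ}
    (hj : j ∉ binIndices k) (z : PredLabel) : binnedResidual (width k) r j z = 0 := by
  rw [binnedResidual_eq_ite_floor (width_pos k), if_neg]
  rintro rfl
  refine hj (Finset.mem_Icc.2 ⟨?_, ?_⟩)
  · rw [Int.le_floor, le_div_iff₀ (width_pos k)]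
    push_cast
    linarith [z.1.2.1, hr.2]
  · have : ((z.1 : ℝ) - r) / width k < ((2 ^ k + 1 : ℤ) : ℝ) := by
      rw [div_lt_iff₀ (width_pos k)]
      have h : (2 : ℝ) ^ k * width k = 1 := by
        rw [width, ← mul_pow]; norm_num
      push_cast
      linarith [z.1.2.2, hr.1, width_pos k]
    exact Int.lt_add_one_iff.1 (Int.floor_lt.2 this)

lemma binMean_eq_zero (Γ : Measure PredLabel) {k : ℕ} {r : ℝ} (hr : r ∈ Set.Ico 0 (width k))
    {j : ℤ} (hj : j ∉ binIndices k) : binMean Γ (width k) r j = 0 := by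
  simp [binMean, binnedResidual_eq_zero hr hj]

lemma empBinMean_eq_zero {n k : ℕ} (z : Fin n → PredLabel) {r : ℝ}
    (hr : r ∈ Set.Ico 0 (width k)) {j : ℤ} (hj : j ∉ binIndices k) :
    empBinMean z (width k) r j = 0 := by
  simp [empBinMean, binnedResidual_eq_zero hr hj]

lemma abs_tsum_empBinMean_sub_shiftCE_le (Γ : Measure PredLabel) {n k : ℕ}
    (z : Fin n → PredLabel) {r : ℝ} (hr : r ∈ Set.Ico 0 (width k)) :
    |∑' j, |empBinMean z (width k) r j| - shiftCE Γ (width k) r| ≤ binDeviation Γ k z r := by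
  have h1 : ∑' j, |empBinMean z (width k) r j| =
      ∑ j ∈ binIndices k, |empBinMean z (width k) r j| :=
    tsum_eq_sum fun j hj => by rw [empBinMean_eq_zero z hr hj, abs_zero]
  have h2 : shiftCE Γ (width k) r = ∑ j ∈ binIndices k, |binMean Γ (width k) r j| :=
    tsum_eq_sum fun j hj => by rw [binMean_eq_zero Γ hr hj, abs_zero]
  rw [h1, h2, ← Finset.sum_sub_distrib]
  exact (Finset.abs_sum_le_sum_abs _ _).trans
    (Finset.sum_le_sum fun j _ => abs_abs_sub_abs_le _ _)

/-- The error of the estimate at one width splits into the sampling error of the examples and the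
sampling error of the shifts. -/
lemma abs_empRintCE_sub_RintCE_le (Γ : Measure PredLabel) {n m k : ℕ} (z : Fin n → PredLabel)
    {r : Fin m → ℝ} (hr : ∀ s, r s ∈ Set.Ico 0 (width k)) :
    |empRintCE z r (width k) - RintCE Γ (width k)| ≤
      (1 / (m : ℝ)) * ∑ s, binDeviation Γ k z (r s) +
        |(1 / (m : ℝ)) * ∑ s, shiftCE Γ (width k) (r s) -
          ∫ r, shiftCE Γ (width k) r ∂(uniformShift (width k))| := by
  refine (abs_sub_le _ ((1 / (m : ℝ)) * ∑ s, shiftCE Γ (width k) (r s)) _).trans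
    (add_le_add ?_ le_rfl)
  change |(1 / (m : ℝ)) * ∑ s, ∑' j, |empBinMean z (width k) (r s) j| - _| ≤ _
  rw [← mul_sub, ← Finset.sum_sub_distrib, abs_mul, abs_of_nonneg (by positivity)]
  gcongr
  exact (Finset.abs_sum_le_sum_abs _ _).trans
    (Finset.sum_le_sum fun s _ => abs_tsum_empBinMean_sub_shiftCE_le Γ z (hr s))

/-- The sum of the bin residuals with signs `+` on `S` and `-` off `S`. -/
noncomputable def signedResidual (k : ℕ) (r : ℝ) (S : Finset ℤ) (z : PredLabel) : ℝ :=
  ∑ j ∈ binIndices k, (if j ∈ S then 1 else -1) * binnedResidual (width k) r j z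

lemma measurable_signedResidual (k : ℕ) (r : ℝ) (S : Finset ℤ) :
    Measurable (signedResidual k r S) :=
  Finset.measurable_fun_sum _ fun j _ => (measurable_binnedResidual (width k) r j).const_mul _

lemma abs_signedResidual_le_one (k : ℕ) (r : ℝ) (S : Finset ℤ) (z : PredLabel) :
    |signedResidual k r S z| ≤ 1 := by
  refine (Finset.abs_sum_le_sum_abs _ _).trans (le_trans (Finset.sum_le_sum fun j _ => ?_)
    (sum_abs_binnedResidual_le_one (width_pos k) r (binIndices k) z))
  rw [abs_mul]
  split_ifs <;> simp

/-- The `ℓ¹` distance is attained by one of the `2 ^ (2 ^ k + 2)` choices of signs. -/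
lemma exists_mul_binDeviation_eq (Γ : Measure PredLabel) [IsProbabilityMeasure Γ] {n : ℕ}
    (hn : 0 < n) (k : ℕ) (z : Fin n → PredLabel) (r : ℝ) :
    ∃ S ∈ (binIndices k).powerset, n * binDeviation Γ k z r =
      ∑ l, (signedResidual k r S (z l) - ∫ x, signedResidual k r S x ∂Γ) := by
  classical
  have hn' : (n : ℝ) ≠ 0 := by exact_mod_cast hn.ne'
  refine ⟨(binIndices k).filter fun j =>
    0 ≤ empBinMean z (width k) r j - binMean Γ (width k) r j, by simp, ?_⟩
  set S := (binIndices k).filter fun j =>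
    0 ≤ empBinMean z (width k) r j - binMean Γ (width k) r j
  have hmean : ∫ x, signedResidual k r S x ∂Γ =
      ∑ j ∈ binIndices k, (if j ∈ S then 1 else -1) * binMean Γ (width k) r j := by
    unfold signedResidual binMean
    rw [integral_finsetSum _ fun j _ =>
      (integrable_binnedResidual Γ (width_pos k) r j).const_mul _]
    simp only [integral_const_mul]
  have hemp : ∑ l, signedResidual k r S (z l) =
      n * ∑ j ∈ binIndices k, (if j ∈ S then 1 else -1) * empBinMean z (width k) r j := by
    unfold signedResidual empBinMean
    rw [Finset.sum_comm, Finset.mul_sum]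
    refine Finset.sum_congr rfl fun j _ => ?_
    rw [← Finset.mul_sum]
    field_simp
  rw [Finset.sum_sub_distrib, hemp, hmean]
  simp only [Finset.sum_const, Finset.card_univ, Fintype.card_fin, nsmul_eq_mul]
  rw [← mul_sub, ← Finset.sum_sub_distrib]
  congr 1
  refine Finset.sum_congr rfl fun j hj => ?_
  rw [← mul_sub]
  by_cases h : 0 ≤ empBinMean z (width k) r j - binMean Γ (width k) r j
  · rw [if_pos (Finset.mem_filter.2 ⟨hj, h⟩), abs_of_nonneg h, one_mul]
  · rw [if_neg (c := j ∈ S) fun hh => h (Finset.mem_filter.1 hh).2,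
      abs_of_neg (not_le.1 h), neg_one_mul]

lemma measurable_binDeviation_uncurry (Γ : Measure PredLabel) [IsProbabilityMeasure Γ]
    (n k : ℕ) : Measurable fun p : (Fin n → PredLabel) × ℝ => binDeviation Γ k p.1 p.2 := by
  refine Finset.measurable_fun_sum _ fun j _ => Measurable.abs (Measurable.sub ?_ ?_)
  · refine (Finset.measurable_fun_sum _ fun l _ => ?_).const_mul _
    exact (measurable_binnedResidual_uncurry (width k) j).comp
      (measurable_snd.prodMk ((measurable_pi_apply l).comp measurable_fst))
  · exact (measurable_binMean Γ (width k) j).comp measurable_snd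

/-- Exponential moment of the deviation: the maximum over the signs is bounded by the sum, and each
term by Hoeffding's lemma. -/
lemma lintegral_exp_binDeviation_le (Γ : Measure PredLabel) [IsProbabilityMeasure Γ] {n : ℕ}
    (hn : 0 < n) (k : ℕ) (r t : ℝ) :
    ∫⁻ z, ENNReal.ofReal (Real.exp (t * (n * binDeviation Γ k z r)))
      ∂(Measure.pi fun _ : Fin n => Γ) ≤
      ENNReal.ofReal (2 ^ (2 ^ k + 2) * Real.exp (n * t ^ 2 / 2)) := by
  have hsub := fun S : Finset ℤ => hasSubgaussianMGF_sum_pi Γ n (measurable_signedResidual k r S)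
    (Filter.Eventually.of_forall (abs_signedResidual_le_one k r S))
  calc _ ≤ ∫⁻ z, ENNReal.ofReal (∑ S ∈ (binIndices k).powerset, Real.exp (t *
          ∑ l, (signedResidual k r S (z l) - ∫ x, signedResidual k r S x ∂Γ)))
          ∂(Measure.pi fun _ : Fin n => Γ) := by
        refine lintegral_mono fun z => ENNReal.ofReal_le_ofReal ?_
        obtain ⟨S, hS, h⟩ := exists_mul_binDeviation_eq Γ hn k z r
        rw [h]
        exact Finset.single_le_sum (f := fun S => Real.exp (t *
          ∑ l, (signedResidual k r S (z l) - ∫ x, signedResidual k r S x ∂Γ)))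
          (fun _ _ => (Real.exp_pos _).le) hS
    _ = ENNReal.ofReal (∫ z, ∑ S ∈ (binIndices k).powerset, Real.exp (t *
          ∑ l, (signedResidual k r S (z l) - ∫ x, signedResidual k r S x ∂Γ))
          ∂(Measure.pi fun _ : Fin n => Γ)) :=
        (ofReal_integral_eq_lintegral_ofReal
          (integrable_finsetSum _ fun S _ => (hsub S).integrable_exp_mul t)
          (Filter.Eventually.of_forall fun z =>
            Finset.sum_nonneg fun _ _ => (Real.exp_pos _).le)).symm
    _ ≤ _ := by
        refine ENNReal.ofReal_le_ofReal ?_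
        rw [integral_finsetSum _ fun S _ => (hsub S).integrable_exp_mul t]
        refine (Finset.sum_le_card_nsmul _ _ _ fun S _ => (hsub S).mgf_le t).trans_eq ?_
        rw [Finset.card_powerset, card_binIndices, nsmul_eq_mul]
        push_cast
        rfl

/-- For fixed shifts, the average over the shifts passes through the exponential by convexity, so
the bound does not depend on the number of shifts. -/
lemma measure_average_binDeviation_ge_le (Γ : Measure PredLabel) [IsProbabilityMeasure Γ]
    {n m : ℕ} (hn : 0 < n) (hm : 0 < m) (k : ℕ) (r : Fin m → ℝ) {t : ℝ} (ht : 0 ≤ t) :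
    (Measure.pi fun _ : Fin n => Γ) {z | t ≤ (1 / (m : ℝ)) * ∑ s, binDeviation Γ k z (r s)} ≤
      ENNReal.ofReal (2 ^ (2 ^ k + 2) * Real.exp (-(n * t ^ 2 / 2))) := by
  have hm' : (0 : ℝ) < m := by exact_mod_cast hm
  -- Chernoff's method with the optimal parameter `n * t`.
  set c : ENNReal := ENNReal.ofReal (Real.exp (n * t ^ 2)) with hc
  have hc0 : c ≠ 0 := by simp [hc, Real.exp_pos]
  have hmeas : ∀ s, Measurable fun z : Fin n → PredLabel =>
      ENNReal.ofReal (Real.exp (t * (n * binDeviation Γ k z (r s)))) := fun s =>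
    ((((measurable_binDeviation_uncurry Γ n k).comp
      (measurable_id.prodMk measurable_const)).const_mul _).const_mul _).exp.ennreal_ofReal
  have hjensen : ∀ z : Fin n → PredLabel,
      Real.exp (t * (n * ((1 / (m : ℝ)) * ∑ s, binDeviation Γ k z (r s)))) ≤
        (1 / (m : ℝ)) * ∑ s, Real.exp (t * (n * binDeviation Γ k z (r s))) := by
    intro z
    have := convexOn_exp.map_sum_le (t := Finset.univ) (w := fun _ : Fin m => 1 / (m : ℝ))
      (p := fun s => t * (n * binDeviation Γ k z (r s))) (fun _ _ => by positivity)
      (by simp [hm'.ne']) (fun _ _ => Set.mem_univ _)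
    simp only [smul_eq_mul] at this
    rw [Finset.mul_sum, Finset.mul_sum, Finset.mul_sum, Finset.mul_sum]
    refine le_of_eq_of_le (congrArg Real.exp (Finset.sum_congr rfl fun s _ => ?_)) this
    ring
  have hint : ∫⁻ z, ENNReal.ofReal (1 / (m : ℝ)) *
      ∑ s, ENNReal.ofReal (Real.exp (t * (n * binDeviation Γ k z (r s))))
      ∂(Measure.pi fun _ : Fin n => Γ) ≤
      ENNReal.ofReal (2 ^ (2 ^ k + 2) * Real.exp (n * t ^ 2 / 2)) := by
    rw [lintegral_const_mul _ (Finset.measurable_fun_sum _ fun s _ => hmeas s),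
      lintegral_finsetSum _ fun s _ => hmeas s]
    calc _ ≤ ENNReal.ofReal (1 / (m : ℝ)) * ∑ _s : Fin m,
          ENNReal.ofReal (2 ^ (2 ^ k + 2) * Real.exp (n * t ^ 2 / 2)) := by
          gcongr with s
          exact lintegral_exp_binDeviation_le Γ hn k (r s) t
      _ = _ := by
          rw [Finset.sum_const, Finset.card_univ, Fintype.card_fin, nsmul_eq_mul, ← mul_assoc,
            ← ENNReal.ofReal_natCast, ← ENNReal.ofReal_mul (by positivity),
            one_div_mul_cancel hm'.ne', ENNReal.ofReal_one, one_mul]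
  calc _ ≤ (Measure.pi fun _ : Fin n => Γ) {z | c ≤ ENNReal.ofReal (1 / (m : ℝ)) *
          ∑ s, ENNReal.ofReal (Real.exp (t * (n * binDeviation Γ k z (r s))))} := by
        refine measure_mono fun z hz => ?_
        simp only [Set.mem_ofPred_eq] at hz ⊢
        rw [← ENNReal.ofReal_sum_of_nonneg fun _ _ => (Real.exp_pos _).le,
          ← ENNReal.ofReal_mul (by positivity)]
        refine ENNReal.ofReal_le_ofReal (le_trans (Real.exp_le_exp.2 ?_) (hjensen z))
        calc n * t ^ 2 = t * (n * t) := by ring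
          _ ≤ _ := by gcongr
    _ ≤ _ := meas_ge_le_lintegral_div
        ((Finset.measurable_fun_sum _ fun s _ => hmeas s).const_mul _).aemeasurable hc0
        ENNReal.ofReal_ne_top
    _ ≤ ENNReal.ofReal (2 ^ (2 ^ k + 2) * Real.exp (n * t ^ 2 / 2)) / c := by gcongr
    _ = _ := by
        rw [hc, ← ENNReal.ofReal_div_of_pos (Real.exp_pos _), mul_div_assoc, ← Real.exp_sub]
        congr 3
        ring

/-! ### Union bound over the widths -/

lemma isProbabilityMeasure_pi_uniformShift (m k : ℕ) :
    IsProbabilityMeasure (Measure.pi fun _ : Fin m => uniformShift (width k)) :=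
  have := isProbabilityMeasure_uniformShift (width_pos k)
  inferInstance

lemma isProbabilityMeasure_drawLaw (Γ : Measure PredLabel) [IsProbabilityMeasure Γ] (n m K : ℕ) :
    IsProbabilityMeasure (drawLaw Γ n m K) := by
  have := fun k => isProbabilityMeasure_pi_uniformShift m k
  unfold drawLaw
  infer_instance

/-- Events that only concern the shifts at one width have the probability given by the law of those
shifts. -/
lemma measurePreserving_drawLaw_shifts (Γ : Measure PredLabel) [IsProbabilityMeasure Γ]
    (n m K : ℕ) (k : Fin (K + 1)) :
    MeasurePreserving (fun ω : (Fin n → PredLabel) × (Fin (K + 1) → Fin m → ℝ) => ω.2 k)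
      (drawLaw Γ n m K) (Measure.pi fun _ : Fin m => uniformShift (width k)) := by
  have := fun k => isProbabilityMeasure_pi_uniformShift m k
  exact (measurePreserving_eval
    (fun k : Fin (K + 1) => Measure.pi fun _ : Fin m => uniformShift (width k)) k).comp
      measurePreserving_snd

lemma ae_drawLaw_shifts_mem (Γ : Measure PredLabel) [IsProbabilityMeasure Γ]
    (n m K : ℕ) (k : Fin (K + 1)) :
    ∀ᵐ ω ∂(drawLaw Γ n m K), ∀ s, ω.2 k s ∈ Set.Ico 0 (width k) := by
  have := isProbabilityMeasure_uniformShift (width_pos k)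
  rw [ae_all_iff]
  intro s
  have hmem : ∀ᵐ x ∂(uniformShift (width k)), x ∈ Set.Ico 0 (width k) :=
    ae_cond_mem measurableSet_Ico
  exact ((measurePreserving_eval (fun _ : Fin m => uniformShift (width k)) s).comp
    (measurePreserving_drawLaw_shifts Γ n m K k)).quasiMeasurePreserving.ae hmem

lemma drawLaw_real_average_shiftCE_ge_le (Γ : Measure PredLabel) [IsProbabilityMeasure Γ]
    (n : ℕ) {m : ℕ} (hm : 0 < m) (K : ℕ) (k : Fin (K + 1)) {t : ℝ} (ht : 0 ≤ t) :
    (drawLaw Γ n m K).real {ω | t ≤ |(1 / (m : ℝ)) * ∑ s, shiftCE Γ (width k) (ω.2 k s) -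
      ∫ r, shiftCE Γ (width k) r ∂(uniformShift (width k))|} ≤
      2 * Real.exp (-(m * t ^ 2 / 2)) := by
  have := isProbabilityMeasure_uniformShift (width_pos k)
  have hsum : Measurable fun r : Fin m → ℝ => ∑ s, shiftCE Γ (width k) (r s) :=
    Finset.measurable_fun_sum _ fun s _ =>
      (measurable_shiftCE Γ (width k)).comp (measurable_pi_apply s)
  refine le_of_eq_of_le ((measurePreserving_drawLaw_shifts Γ n m K k).measureReal_preimage
    (s := {r | t ≤ |(1 / (m : ℝ)) * ∑ s, shiftCE Γ (width k) (r s) -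
      ∫ r, shiftCE Γ (width k) r ∂(uniformShift (width k))|}) ?_)
    (measureReal_abs_average_sub_ge_le (uniformShift (width k)) hm (measurable_shiftCE Γ (width k))
      (Filter.Eventually.of_forall (abs_shiftCE_le_one Γ (width_pos k))) ht)
  exact (measurableSet_le measurable_const
    ((hsum.const_mul _).sub_const _).abs).nullMeasurableSet

lemma measurable_average_binDeviation (Γ : Measure PredLabel) [IsProbabilityMeasure Γ]
    (n m k : ℕ) : Measurable fun p : (Fin n → PredLabel) × (Fin m → ℝ) =>
      (1 / (m : ℝ)) * ∑ s, binDeviation Γ k p.1 (p.2 s) := by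
  refine (Finset.measurable_fun_sum _ fun s _ => ?_).const_mul _
  have h : Measurable fun p : (Fin n → PredLabel) × (Fin m → ℝ) => (p.1, p.2 s) :=
    measurable_fst.prodMk ((measurable_pi_apply s).comp measurable_snd)
  have h' := (measurable_binDeviation_uncurry Γ n k).comp h
  exact h'

lemma drawLaw_real_average_binDeviation_ge_le (Γ : Measure PredLabel) [IsProbabilityMeasure Γ]
    {n m : ℕ} (hn : 0 < n) (hm : 0 < m) (K : ℕ) (k : Fin (K + 1)) {t : ℝ} (ht : 0 ≤ t) :
    (drawLaw Γ n m K).real {ω | t ≤ (1 / (m : ℝ)) * ∑ s, binDeviation Γ k ω.1 (ω.2 k s)} ≤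
      2 ^ (2 ^ (k : ℕ) + 2) * Real.exp (-(n * t ^ 2 / 2)) := by
  have := fun k => isProbabilityMeasure_pi_uniformShift m k
  refine ENNReal.toReal_le_of_le_ofReal (by positivity) ?_
  have hpair : Measurable fun ω : (Fin n → PredLabel) × (Fin (K + 1) → Fin m → ℝ) =>
      (ω.1, ω.2 k) := measurable_fst.prodMk ((measurable_pi_apply k).comp measurable_snd)
  have havg := (measurable_average_binDeviation Γ n m k).comp hpair
  have hmeas : MeasurableSet {ω : (Fin n → PredLabel) × (Fin (K + 1) → Fin m → ℝ) |
      t ≤ (1 / (m : ℝ)) * ∑ s, binDeviation Γ k ω.1 (ω.2 k s)} :=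
    measurableSet_le measurable_const havg
  -- Condition on the shifts: the bound for fixed shifts does not depend on them.
  rw [drawLaw, Measure.prod_apply_symm hmeas]
  have hle : ∀ r : Fin (K + 1) → Fin m → ℝ, (Measure.pi fun _ : Fin n => Γ)
      ((fun z => (z, r)) ⁻¹' {ω : (Fin n → PredLabel) × (Fin (K + 1) → Fin m → ℝ) |
        t ≤ (1 / (m : ℝ)) * ∑ s, binDeviation Γ k ω.1 (ω.2 k s)}) ≤
      ENNReal.ofReal (2 ^ (2 ^ (k : ℕ) + 2) * Real.exp (-(n * t ^ 2 / 2))) := by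
    intro r
    have h := measure_average_binDeviation_ge_le Γ hn hm k (r k) ht
    exact h
  refine (lintegral_mono hle).trans ?_
  rw [lintegral_const, measure_univ, mul_one]

/-- Failure probability of the simultaneous estimate of `RintCE` at the widths `2^{-k}`, `k ≤ K`. -/
lemma drawLaw_real_exists_empRintCE_error_le (Γ : Measure PredLabel) [IsProbabilityMeasure Γ]
    {n m : ℕ} (hn : 0 < n) (hm : 0 < m) (K : ℕ) {t : ℝ} (ht : 0 ≤ t) :
    (drawLaw Γ n m K).real {ω | ∃ k : Fin (K + 1),
      2 * t < |empRintCE ω.1 (ω.2 k) (width k) - RintCE Γ (width k)|} ≤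
      (K + 1) * (2 ^ (2 ^ K + 2) * Real.exp (-(n * t ^ 2 / 2)) +
        2 * Real.exp (-(m * t ^ 2 / 2))) := by
  have := isProbabilityMeasure_drawLaw Γ n m K
  have hk : ∀ k : Fin (K + 1), (drawLaw Γ n m K).real {ω |
      2 * t < |empRintCE ω.1 (ω.2 k) (width k) - RintCE Γ (width k)|} ≤
      2 ^ (2 ^ K + 2) * Real.exp (-(n * t ^ 2 / 2)) + 2 * Real.exp (-(m * t ^ 2 / 2)) := by
    intro k
    have hnull : (drawLaw Γ n m K).real {ω | ¬ ∀ s, ω.2 k s ∈ Set.Ico 0 (width k)} = 0 := by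
      rw [measureReal_def, ae_iff.1 (ae_drawLaw_shifts_mem Γ n m K k), ENNReal.toReal_zero]
    have hpow : (2 : ℝ) ^ (2 ^ (k : ℕ) + 2) ≤ 2 ^ (2 ^ K + 2) := by
      have : (k : ℕ) ≤ K := Nat.lt_succ_iff.1 k.2
      gcongr <;> norm_num
    calc _ ≤ (drawLaw Γ n m K).real ({ω | ¬ ∀ s, ω.2 k s ∈ Set.Ico 0 (width k)} ∪
          ({ω | t ≤ (1 / (m : ℝ)) * ∑ s, binDeviation Γ k ω.1 (ω.2 k s)} ∪
          {ω | t ≤ |(1 / (m : ℝ)) * ∑ s, shiftCE Γ (width k) (ω.2 k s) -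
            ∫ r, shiftCE Γ (width k) r ∂(uniformShift (width k))|})) := by
          refine measureReal_mono fun ω hω => ?_
          by_contra hcon
          simp only [Set.mem_union, Set.mem_ofPred_eq, not_or, not_not, not_le] at hcon hω
          obtain ⟨h1, h2, h3⟩ := hcon
          linarith [abs_empRintCE_sub_RintCE_le Γ ω.1 h1]
      _ ≤ 0 + (2 ^ (2 ^ (k : ℕ) + 2) * Real.exp (-(n * t ^ 2 / 2)) +
            2 * Real.exp (-(m * t ^ 2 / 2))) := by
          refine (measureReal_union_le _ _).trans (add_le_add hnull.le ?_)
          exact (measureReal_union_le _ _).trans (add_le_add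
            (drawLaw_real_average_binDeviation_ge_le Γ hn hm K k ht)
            (drawLaw_real_average_shiftCE_ge_le Γ n hm K k ht))
      _ ≤ _ := by
          rw [zero_add]
          gcongr
  rw [Set.ofPred_exists]
  refine (measureReal_iUnion_fintype_le _).trans ((Finset.sum_le_sum fun k _ => hk k).trans_eq ?_)
  rw [Finset.sum_const, Finset.card_univ, Fintype.card_fin, nsmul_eq_mul]
  push_cast
  rfl

/-! ### The sample sizes -/

/-- The number of examples absorbs the `2 ^ (2 ^ K + 2)` sign patterns, as `2 ^ K < 4 / ε`, and the
`K + 1` widths, as `K + 1 ≤ 2 ^ K`. -/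
lemma examples_failure_le {ε δ : ℝ} (hε : 0 < ε) (hε' : ε < 1 / 4) (hδ : 0 < δ) (hδ' : δ < 1 / 4)
    {K : ℕ} (hK : ε / 4 < (1 / 2 : ℝ) ^ K) {n : ℕ}
    (hn : 288 / ε ^ 3 + 288 / ε ^ 2 * Real.log (1 / δ) ≤ (n : ℝ)) :
    (K + 1) * (2 ^ (2 ^ K + 2) * Real.exp (-(n * (ε / 4) ^ 2 / 2))) ≤ δ / 2 := by
  have hlog : 0 < Real.log (1 / δ) := Real.log_pos (by rw [lt_div_iff₀ hδ]; linarith)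
  have hpow : (2 : ℝ) ^ K * ε < 4 := by
    have h : (2 : ℝ) ^ K * (1 / 2) ^ K = 1 := by rw [← mul_pow]; norm_num
    have : (2 : ℝ) ^ K * (ε / 4) < 2 ^ K * (1 / 2) ^ K := by gcongr
    linarith
  have hN : ((2 * 2 ^ K + 3 : ℕ) : ℝ) ≤ 9 / ε := by
    rw [le_div_iff₀ hε]
    push_cast
    nlinarith
  have hcount : ((K : ℝ) + 1) * 2 ^ (2 ^ K + 2) * 2 ≤ Real.exp (9 / ε) := by
    have h1 : (K : ℝ) + 1 ≤ 2 ^ (2 ^ K) := by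
      have h : K + 1 ≤ 2 ^ (2 ^ K) := (Nat.lt_two_pow_self (n := K)).trans Nat.lt_two_pow_self
      exact_mod_cast h
    calc ((K : ℝ) + 1) * 2 ^ (2 ^ K + 2) * 2 ≤ 2 ^ (2 ^ K) * 2 ^ (2 ^ K + 2) * 2 := by gcongr
      _ = 2 ^ (2 * 2 ^ K + 3) := by ring
      _ ≤ Real.exp 1 ^ (2 * 2 ^ K + 3) := by
          gcongr
          linarith [Real.add_one_le_exp 1]
      _ = Real.exp ((2 * 2 ^ K + 3 : ℕ) : ℝ) := by rw [← Real.exp_nat_mul, mul_one]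
      _ ≤ _ := Real.exp_le_exp.2 hN
  have hexp : Real.exp (-(n * (ε / 4) ^ 2 / 2)) ≤ Real.exp (-(9 / ε)) * δ := by
    calc _ ≤ Real.exp (-(9 / ε) - Real.log (1 / δ)) := by
          refine Real.exp_le_exp.2 ?_
          have h : (288 / ε ^ 3 + 288 / ε ^ 2 * Real.log (1 / δ)) * (ε ^ 2 / 32) ≤
            n * (ε ^ 2 / 32) := by gcongr
          have h2 : (288 / ε ^ 3 + 288 / ε ^ 2 * Real.log (1 / δ)) * (ε ^ 2 / 32) =
            9 / ε + 9 * Real.log (1 / δ) := by field_simp; ring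
          rw [h2] at h
          nlinarith
      _ = _ := by
          rw [sub_eq_add_neg, Real.exp_add, one_div, Real.log_inv, neg_neg, Real.exp_log hδ]
  calc _ = ((K : ℝ) + 1) * 2 ^ (2 ^ K + 2) * 2 * Real.exp (-(n * (ε / 4) ^ 2 / 2)) / 2 := by ring
    _ ≤ Real.exp (9 / ε) * (Real.exp (-(9 / ε)) * δ) / 2 := by gcongr
    _ = δ / 2 := by
        rw [← mul_assoc, ← Real.exp_add, add_neg_cancel, Real.exp_zero, one_mul]

/-- Here `exp (-m ε² / 32) ≤ (δ / K)²`, and the square leaves room for the `K + 1` widths. -/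
lemma shifts_failure_le {ε δ : ℝ} (hε : 0 < ε) (hδ : 0 < δ) (hδ' : δ < 1 / 4)
    {K : ℕ} (hK : 2 ≤ K) {m : ℕ} (hm : 288 / ε ^ 2 * Real.log ((K : ℝ) / δ) ≤ (m : ℝ)) :
    (K + 1) * (2 * Real.exp (-(m * (ε / 4) ^ 2 / 2))) ≤ δ / 2 := by
  have hK' : (2 : ℝ) ≤ K := by exact_mod_cast hK
  have hlog : 0 < Real.log (K / δ) := Real.log_pos (by rw [lt_div_iff₀ hδ]; linarith)
  have hexp : Real.exp (-(m * (ε / 4) ^ 2 / 2)) ≤ (δ / K) ^ 2 := by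
    calc _ ≤ Real.exp (-(2 * Real.log (K / δ))) := by
          refine Real.exp_le_exp.2 ?_
          have h : 288 / ε ^ 2 * Real.log ((K : ℝ) / δ) * (ε ^ 2 / 32) ≤ m * (ε ^ 2 / 32) := by
            gcongr
          have h2 : 288 / ε ^ 2 * Real.log ((K : ℝ) / δ) * (ε ^ 2 / 32) =
            9 * Real.log (K / δ) := by field_simp; ring
          rw [h2] at h
          nlinarith
      _ = _ := by
          have h : -(2 * Real.log (K / δ)) = (2 : ℕ) * Real.log (δ / K) := by
            rw [← inv_div (δ : ℝ) K, Real.log_inv]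
            push_cast
            ring
          rw [h, Real.exp_nat_mul, Real.exp_log (by positivity)]
  calc _ ≤ ((K : ℝ) + 1) * (2 * (δ / K) ^ 2) := by gcongr
    _ ≤ δ / 2 := by
        rw [div_pow, ← mul_div_assoc, ← mul_div_assoc, div_le_iff₀ (by positivity)]
        have h1 : ((K : ℝ) + 1) * δ * (4 * δ) ≤ K ^ 2 * δ * 1 := by
          gcongr
          · nlinarith
          · linarith
        linarith

end IntervalCalibration

theorem mainTheorem8 :
    ∃ C : ℝ, 0 < C ∧
      ∀ ε δ : ℝ, 0 < ε → ε < 1 / 4 → 0 < δ → δ < 1 / 4 →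
      ∀ kstar : ℕ, ε / 4 < (1 / 2 : ℝ) ^ kstar → (1 / 2 : ℝ) ^ kstar ≤ ε / 2 →
      ∀ n m : ℕ, C / ε ^ 3 + C / ε ^ 2 * Real.log (1 / δ) ≤ (n : ℝ) →
        C / ε ^ 2 * Real.log ((kstar : ℝ) / δ) ≤ (m : ℝ) →
      ∀ (Γ : MeasureTheory.Measure IntervalCalibration.PredLabel)
        [MeasureTheory.IsProbabilityMeasure Γ],
        1 - δ ≤ (IntervalCalibration.drawLaw Γ n m kstar).real
          {ω | |IntervalCalibration.empSintCE ω.1 ω.2 - IntervalCalibration.SintCE Γ| ≤ ε} := by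
  open IntervalCalibration in
  -- `288 = 9 * 32`: Hoeffding's exponent at deviation `ε / 4` is `n ε² / 32`, and `9 / ε` bounds the
  -- logarithm of the number of sign patterns and widths.
  refine ⟨288, by norm_num, fun ε δ hε hε' hδ hδ' K hK hK' n m hn hm Γ _ => ?_⟩
  have := isProbabilityMeasure_drawLaw Γ n m K
  -- As `2 ^ (-K) ≤ ε / 2 < 1 / 8`, the logarithm in the bound on `m` is positive, so that `m > 0`.
  have hK2 : 2 ≤ K := by
    by_contra hlt
    have : (1 / 2 : ℝ) ^ 1 ≤ (1 / 2) ^ K :=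
      pow_le_pow_of_le_one (by norm_num) (by norm_num) (by omega)
    linarith
  have hlog : 0 < Real.log (1 / δ) := Real.log_pos (by rw [lt_div_iff₀ hδ]; linarith)
  have hn0 : 0 < n := by
    have : (0 : ℝ) < n := lt_of_lt_of_le (by positivity) hn
    exact_mod_cast this
  have hm0 : 0 < m := by
    have hK2' : (2 : ℝ) ≤ K := by exact_mod_cast hK2
    have hlog' : 0 < Real.log (K / δ) := Real.log_pos (by rw [lt_div_iff₀ hδ]; linarith)
    have : (0 : ℝ) < m := lt_of_lt_of_le (by positivity) hm
    exact_mod_cast this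
  have hbad := drawLaw_real_exists_empRintCE_error_le Γ hn0 hm0 K (t := ε / 4) (by positivity)
  rw [mul_add] at hbad
  have hfail := hbad.trans (add_le_add (examples_failure_le hε hε' hδ hδ' hK hn)
    (shifts_failure_le hε hδ hδ' hK2 hm))
  have hcover : (1 : ℝ) ≤ (drawLaw Γ n m K).real {ω | |empSintCE ω.1 ω.2 - SintCE Γ| ≤ ε} +
      (drawLaw Γ n m K).real {ω | ∃ k : Fin (K + 1),
        2 * (ε / 4) < |empRintCE ω.1 (ω.2 k) (width k) - RintCE Γ (width k)|} := by
    refine (probReal_univ (μ := drawLaw Γ n m K)).symm.le.trans ?_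
    refine (measureReal_mono fun ω _ => ?_).trans (measureReal_union_le _ _)
    refine or_iff_not_imp_right.2 fun hω => ?_
    simp only [Set.mem_ofPred_eq, not_exists, not_lt] at hω
    have h := abs_inf'_sub_SintCE_le Γ K (fun k => empRintCE ω.1 (ω.2 k) (width k)) hω
    have hw : width K ≤ ε / 2 := hK'
    exact h.trans (by linarith)
  linarith
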